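/- Let $\mathbb F_2^n$ be the set of binary words of length $n$. An $(n,d,w)$-code is a set $C\subseteq\mathbb F_2^n$ all of whose words have weight (number of nonzero entries) $w$ and in which any two distinct words have Hamming distance at least $d$. Let $G\subseteq\mathbb F_2^{24}$ be the extended binary Golay code, that is, the $\mathbb F_2$-linear span of the rows of the $12\times 24$ matrix $[\,I_{12}\mid B\,]$, where $$B=\begin{pmatrix} Q & \mathbf 1\\ \mathbf 1^{T} & 0\end{pmatrix}$$ and $Q=(q_{ij})_{0\le i,j\le 10}$ has $q_{ij}=1$ if $j-i$ is a square modulo $11$ (zero included) and $q_{ij}=0$ otherwise. Then, up to permutations of the $24$ coordinate positions, there is a unique $(24,8,12)$-code of size $2576$, and an example is given by the set $G_{12}$ of words of weight $12$ in $G$. That is, $G_{12}$ is a $(24,8,12)$-code of size $2576$, and every $(24,8,12)$-code of size $2576$ is obtained from $G_{12}$ by a permutation of the coordinate positions. -/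

import Mathlib

/-- A binary code of word length `n`: a subset of `𝔽₂ⁿ`. -/
abbrev BinaryCode (n : ℕ) : Type := Set (Fin n → ZMod 2)

namespace BinaryCode

/-- The minimum distance of a code: the minimum of the Hamming distance over all pairs of distinct
code words, equal to `∞` if there is no such pair. -/
noncomputable def minDist {n : ℕ} (C : BinaryCode n) : ℕ∞ :=
  ⨅ (u ∈ C) (v ∈ C) (_ : u ≠ v), (hammingDist u v : ℕ∞)

theorem le_minDist_iff {n : ℕ} (C : BinaryCode n) (d : ℕ) :
    (d : ℕ∞) ≤ C.minDist ↔ ∀ u ∈ C, ∀ v ∈ C, u ≠ v → d ≤ hammingDist u v := by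
  simp only [minDist, le_iInf_iff, Nat.cast_le]

/-- `C` is an `(n, d, w)`-code: all code words have weight `w` and the minimum distance of `C` is at
least `d`. -/
structure IsConstantWeightCode (n d w : ℕ) (C : BinaryCode n) : Prop where
  weight_eq : ∀ u ∈ C, hammingNorm u = w
  le_minDist : (d : ℕ∞) ≤ C.minDist

/-- The code obtained from `C` by permuting the coordinate positions by `σ`. -/
def permute {n : ℕ} (σ : Equiv.Perm (Fin n)) (C : BinaryCode n) : BinaryCode n :=
  (fun (u : Fin n → ZMod 2) (i : Fin n) => u (σ i)) '' C

/-- The codes `C` and `D` are the same up to a permutation of the coordinate positions. -/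
def PermEquiv {n : ℕ} (C D : BinaryCode n) : Prop :=
  ∃ σ : Equiv.Perm (Fin n), D = C.permute σ

end BinaryCode

/-- The standard generator matrix `[I₁₂ | B]` of the extended binary Golay code, where `B` is the
`11 × 11` circulant matrix with a one in position `(i, j)` if and only if `j - i` is a square
modulo `11` (zero included), bordered by ones and with a zero in the lower right corner. -/
def golayGenerator : Matrix (Fin 12) (Fin 24) (ZMod 2) :=
  !![1, 0, 0, 0, 0, 0, 0, 0, 0, 0, 0, 0, 1, 1, 0, 1, 1, 1, 0, 0, 0, 1, 0, 1;
     0, 1, 0, 0, 0, 0, 0, 0, 0, 0, 0, 0, 0, 1, 1, 0, 1, 1, 1, 0, 0, 0, 1, 1;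
     0, 0, 1, 0, 0, 0, 0, 0, 0, 0, 0, 0, 1, 0, 1, 1, 0, 1, 1, 1, 0, 0, 0, 1;
     0, 0, 0, 1, 0, 0, 0, 0, 0, 0, 0, 0, 0, 1, 0, 1, 1, 0, 1, 1, 1, 0, 0, 1;
     0, 0, 0, 0, 1, 0, 0, 0, 0, 0, 0, 0, 0, 0, 1, 0, 1, 1, 0, 1, 1, 1, 0, 1;
     0, 0, 0, 0, 0, 1, 0, 0, 0, 0, 0, 0, 0, 0, 0, 1, 0, 1, 1, 0, 1, 1, 1, 1;
     0, 0, 0, 0, 0, 0, 1, 0, 0, 0, 0, 0, 1, 0, 0, 0, 1, 0, 1, 1, 0, 1, 1, 1;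
     0, 0, 0, 0, 0, 0, 0, 1, 0, 0, 0, 0, 1, 1, 0, 0, 0, 1, 0, 1, 1, 0, 1, 1;
     0, 0, 0, 0, 0, 0, 0, 0, 1, 0, 0, 0, 1, 1, 1, 0, 0, 0, 1, 0, 1, 1, 0, 1;
     0, 0, 0, 0, 0, 0, 0, 0, 0, 1, 0, 0, 0, 1, 1, 1, 0, 0, 0, 1, 0, 1, 1, 1;
     0, 0, 0, 0, 0, 0, 0, 0, 0, 0, 1, 0, 1, 0, 1, 1, 1, 0, 0, 0, 1, 0, 1, 1;
     0, 0, 0, 0, 0, 0, 0, 0, 0, 0, 0, 1, 1, 1, 1, 1, 1, 1, 1, 1, 1, 1, 1, 0]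

/-- The extended binary Golay code: the `𝔽₂`-linear span of the rows of `golayGenerator`. -/
def extendedGolayCode : Submodule (ZMod 2) (Fin 24 → ZMod 2) :=
  Submodule.span (ZMod 2) (Set.range golayGenerator.row)

/-- The set of words of weight `12` in the extended binary Golay code. -/
def golayDodecads : BinaryCode 24 :=
  {u | u ∈ extendedGolayCode ∧ hammingNorm u = 12}

/-! The parity of the intersections comes from linear programming in the Johnson scheme J(24,12).
The kernels `johnsonKernel` are positive semidefinite, and `delsarteFunction` combines them with
nonnegative coefficients, its value being nonpositive on every intersection size allowed for
distinct words. Summing it over all pairs of words gives |C| ≤ 2576. In the case of equality every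
off-diagonal term vanishes, while the function is strictly negative at odd sizes, so any two words
meet evenly (`even_card_inter_of_card_eq`).

The linear span of such a code is therefore self-orthogonal and doubly even. It has more than 2^11
words, hence dimension 12, and is self-dual. A word of weight 4 would give a second, disjoint copy
of the code inside the span, and 2 · 2576 > 2^12; so the minimum weight is at least 8
(`isGolayFamily_wordSpan`).

Such a span is determined up to coordinates. Let L be a dodecad, u ∈ L and v ∉ L. The span words
through v that meet L in {u, j} trace a 2-(11,5,2) design on the remaining 11 positions of the
complement of L. This biplane is unique (`IsBiplane.exists_equiv`), and together with L it generates
the span (`generated`). Hence a permutation carries the span of any optimal code into the span of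
the Golay dodecads. It maps the code into `golayDodecads`, and equality follows by counting. -/

open Finset

/-! ### Positive semidefinite kernels on the Johnson scheme -/

section JohnsonKernel

variable {α : Type*} [DecidableEq α]

/-- The indicator of a finite set, with integer values. -/
def setIndicator (A : Finset α) (a : α) : ℤ := if a ∈ A then 1 else 0

/-- The zonal kernel of the Johnson scheme attached to products of `k` differences of coordinates
at distinct positions of `S`. -/
def johnsonKernel : ℕ → Finset α → Finset α → Finset α → ℤ
  | 0, _, _, _ => 1
  | k + 1, S, A, B => ∑ a ∈ S, ∑ b ∈ S,
      (setIndicator A a - setIndicator A b) * (setIndicator B a - setIndicator B b) *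
        johnsonKernel k ((S.erase a).erase b) A B

/-- The values of `johnsonKernel`, as a function of the numbers of positions of each type. -/
def johnsonValue : ℕ → ℕ → ℕ → ℕ → ℕ → ℤ
  | 0, _, _, _, _ => 1
  | k + 1, a, b, c, d =>
      2 * a * d * johnsonValue k (a - 1) b c (d - 1) - 2 * b * c * johnsonValue k a (b - 1) (c - 1) d

/-- The kernel is a sum of products φ(A)φ(B), with φ a product of k coordinate differences. In the
induction one difference is absorbed into the weight, which is why `w` is arbitrary. -/
theorem johnsonKernel_sum_nonneg (k : ℕ) (S : Finset α) (C : Finset (Finset α))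
    (w : Finset α → ℤ) :
    0 ≤ ∑ A ∈ C, ∑ B ∈ C, w A * w B * johnsonKernel k S A B := by
  induction k generalizing S w with
  | zero =>
    simp only [johnsonKernel, mul_one]
    rw [← Finset.sum_mul_sum]
    exact mul_self_nonneg _
  | succ k ih =>
    have key : ∑ A ∈ C, ∑ B ∈ C, w A * w B * johnsonKernel (k + 1) S A B =
        ∑ a ∈ S, ∑ b ∈ S, ∑ A ∈ C, ∑ B ∈ C,
          (w A * (setIndicator A a - setIndicator A b)) *
          (w B * (setIndicator B a - setIndicator B b)) *
            johnsonKernel k ((S.erase a).erase b) A B := by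
      simp only [johnsonKernel, Finset.mul_sum]
      rw [Finset.sum_congr rfl fun A _ => Finset.sum_comm (s := C) (t := S)]
      rw [Finset.sum_comm (s := C) (t := S)]
      refine Finset.sum_congr rfl fun a _ => ?_
      rw [Finset.sum_congr rfl fun A _ => Finset.sum_comm (s := C) (t := S)]
      rw [Finset.sum_comm (s := C) (t := S)]
      refine Finset.sum_congr rfl fun b _ => Finset.sum_congr rfl fun A _ =>
        Finset.sum_congr rfl fun B _ => ?_
      ring
    rw [key]
    exact Finset.sum_nonneg fun a _ => Finset.sum_nonneg fun b _ => ih _ _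

theorem sum_setIndicator_mul_sum_setIndicator (S T U : Finset α) (x : ℤ) :
    ∑ a ∈ S, ∑ b ∈ S, setIndicator T a * setIndicator U b * x = #(S ∩ T) * #(S ∩ U) * x := by
  simp_rw [← Finset.sum_mul]
  rw [← Finset.sum_mul_sum]
  simp [setIndicator, Finset.sum_ite_mem]

/-- A pair of positions contributes +1 if one lies in both sets and the other in neither, -1 if one
lies in each difference, and 0 otherwise. Removing the pair lowers the two counts involved by one.
Truncated subtraction in `johnsonValue` is harmless, since the coefficient is then zero. Writing the
last count as `S ∩ (S \ (A ∪ B))` gives all four the shape `S ∩ T`. -/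
theorem johnsonKernel_eq (k : ℕ) (S A B : Finset α) :
    johnsonKernel k S A B =
      johnsonValue k #(S ∩ (A ∩ B)) #(S ∩ (A \ B)) #(S ∩ (B \ A)) #(S ∩ (S \ (A ∪ B))) := by
  induction k generalizing S with
  | zero => rfl
  | succ k ih =>
    have e1 : ∀ (T : Finset α) (a b : α), a ∈ S ∩ T → b ∉ T →
        #(((S.erase a).erase b) ∩ T) = #(S ∩ T) - 1 := fun T a b ha hb => by
      rw [← Finset.card_erase_of_mem ha]
      congr 1
      ext x
      simp only [mem_inter, mem_erase]
      constructor
      · tauto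
      · rintro ⟨h1, h2, h3⟩
        exact ⟨⟨fun h => hb (h ▸ h3), h1, h2⟩, h3⟩
    have e2 : ∀ (T : Finset α) (a b : α), a ∉ T → b ∈ S ∩ T →
        #(((S.erase a).erase b) ∩ T) = #(S ∩ T) - 1 := fun T a b ha hb => by
      rw [Finset.erase_right_comm]
      exact e1 T b a hb ha
    have e0 : ∀ (T : Finset α) (a b : α), a ∉ T → b ∉ T →
        #(((S.erase a).erase b) ∩ T) = #(S ∩ T) := fun T a b ha hb => by
      congr 1
      ext x
      simp only [mem_inter, mem_erase]
      constructor
      · tauto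
      · rintro ⟨h1, h2⟩
        exact ⟨⟨fun h => hb (h ▸ h2), fun h => ha (h ▸ h2), h1⟩, h2⟩
    have e3 : ∀ (a b : α), ((S.erase a).erase b) ∩ (((S.erase a).erase b) \ (A ∪ B)) =
        ((S.erase a).erase b) ∩ (S \ (A ∪ B)) := fun a b => by
      ext x
      simp only [mem_inter, mem_erase, mem_sdiff]
      tauto
    set X := johnsonValue k (#(S ∩ (A ∩ B)) - 1) #(S ∩ (A \ B)) #(S ∩ (B \ A))
      (#(S ∩ (S \ (A ∪ B))) - 1) with hX
    set Y := johnsonValue k #(S ∩ (A ∩ B)) (#(S ∩ (A \ B)) - 1) (#(S ∩ (B \ A)) - 1)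
      #(S ∩ (S \ (A ∪ B))) with hY
    have key : ∀ a ∈ S, ∀ b ∈ S,
        (setIndicator A a - setIndicator A b) * (setIndicator B a - setIndicator B b) *
          johnsonKernel k ((S.erase a).erase b) A B =
        setIndicator (A ∩ B) a * setIndicator (S \ (A ∪ B)) b * X +
        setIndicator (S \ (A ∪ B)) a * setIndicator (A ∩ B) b * X -
        (setIndicator (A \ B) a * setIndicator (B \ A) b * Y +
        setIndicator (B \ A) a * setIndicator (A \ B) b * Y) := by
      intro a ha b hb
      rw [ih, e3]
      by_cases h1 : a ∈ A <;> by_cases h2 : a ∈ B <;> by_cases h3 : b ∈ A <;> by_cases h4 : b ∈ B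
      all_goals simp only [setIndicator, mem_inter, mem_sdiff, mem_union, ha, hb, h1, h2, h3, h4,
        and_true, and_false, or_true, or_false, not_true, not_false_eq_true, if_true, if_false,
        and_self, or_self, sub_self, mul_zero, zero_mul, add_zero, zero_add, sub_zero, mul_one, one_mul]
      · rw [hX, e1, e0, e0, e2] <;> simp [*]
      · rw [hY, e0, e1, e2, e0] <;> simp [*]
      · rw [hY, e0, e2, e1, e0] <;> simp [*]
      · rw [hX, e2, e0, e0, e1] <;> simp [*]
    rw [johnsonKernel, Finset.sum_congr rfl fun a ha => Finset.sum_congr rfl (key a ha)]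
    simp only [Finset.sum_sub_distrib, Finset.sum_add_distrib,
      sum_setIndicator_mul_sum_setIndicator]
    rw [johnsonValue]
    ring

end JohnsonKernel

/-! ### The Delsarte bound and its case of equality -/

/-- A function on the Johnson scheme `J(24, 12)` whose coefficients on the zonal kernels are
nonnegative: an optimal solution of the dual Delsarte linear program for minimum distance `8`,
scaled to be integral. The argument is the size of the intersection of two `12`-sets. -/
def delsarteFunction (t : ℕ) : ℤ :=
  583896481962393600000 +
  35060617912320000000 * johnsonValue 1 t (12 - t) (12 - t) t +
  672585027932160000 * johnsonValue 2 t (12 - t) (12 - t) t +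
  14249235087360000 * johnsonValue 3 t (12 - t) (12 - t) t +
  118787026176000 * johnsonValue 4 t (12 - t) (12 - t) t +
  1879781904000 * johnsonValue 5 t (12 - t) (12 - t) t +
  7429 * johnsonValue 10 t (12 - t) (12 - t) t

set_option maxRecDepth 100000 in
theorem delsarteFunction_twelve : delsarteFunction 12 = 2576 * 583896481962393600000 := by
  decide +kernel

set_option maxRecDepth 100000 in
theorem delsarteFunction_nonpos : ∀ t < 9, delsarteFunction t ≤ 0 := by
  decide +kernel

set_option maxRecDepth 100000 in
theorem delsarteFunction_neg_of_odd : ∀ t < 9, t % 2 = 1 → delsarteFunction t < 0 := by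
  decide +kernel

theorem delsarteFunction_sum_ge (C : Finset (Finset (Fin 24))) (hC : ∀ A ∈ C, #A = 12) :
    583896481962393600000 * (#C : ℤ) ^ 2 ≤ ∑ A ∈ C, ∑ B ∈ C, delsarteFunction #(A ∩ B) := by
  -- Two 12-sets meeting in t of 24 positions have t positions in both and t in neither. The factor
  -- `1 * 1` matches the constant weight in `johnsonKernel_sum_nonneg`.
  have hval : ∀ k, ∀ A ∈ C, ∀ B ∈ C, johnsonValue k #(A ∩ B) (12 - #(A ∩ B)) (12 - #(A ∩ B))
      #(A ∩ B) = 1 * 1 * johnsonKernel k univ A B := by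
    intro k A hA B hB
    rw [johnsonKernel_eq]
    have h1 := hC A hA
    have h2 := hC B hB
    have h3 := Finset.card_sdiff_add_card_inter A B
    have h4 := Finset.card_sdiff_add_card_inter B A
    have h5 := Finset.card_union_add_card_inter A B
    have h6 := Finset.card_compl (A ∪ B)
    rw [Finset.inter_comm B A] at h4
    rw [Fintype.card_fin] at h6
    simp only [univ_inter, mul_one, one_mul, ← Finset.compl_eq_univ_sdiff]
    congr 1 <;> omega
  have hnn := fun k => johnsonKernel_sum_nonneg k (univ : Finset (Fin 24)) C (fun _ => 1)
  have hsum : ∑ A ∈ C, ∑ B ∈ C, delsarteFunction #(A ∩ B) =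
      583896481962393600000 * (#C : ℤ) ^ 2 +
      35060617912320000000 * (∑ A ∈ C, ∑ B ∈ C, 1 * 1 * johnsonKernel 1 univ A B) +
      672585027932160000 * (∑ A ∈ C, ∑ B ∈ C, 1 * 1 * johnsonKernel 2 univ A B) +
      14249235087360000 * (∑ A ∈ C, ∑ B ∈ C, 1 * 1 * johnsonKernel 3 univ A B) +
      118787026176000 * (∑ A ∈ C, ∑ B ∈ C, 1 * 1 * johnsonKernel 4 univ A B) +
      1879781904000 * (∑ A ∈ C, ∑ B ∈ C, 1 * 1 * johnsonKernel 5 univ A B) +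
      7429 * (∑ A ∈ C, ∑ B ∈ C, 1 * 1 * johnsonKernel 10 univ A B) := by
    rw [Finset.sum_congr rfl fun A hA => Finset.sum_congr rfl fun B hB => by
      rw [delsarteFunction, hval 1 A hA B hB, hval 2 A hA B hB, hval 3 A hA B hB,
        hval 4 A hA B hB, hval 5 A hA B hB, hval 10 A hA B hB]]
    simp only [Finset.sum_add_distrib, Finset.mul_sum, Finset.sum_const, nsmul_eq_mul]
    ring
  rw [hsum]
  linarith [hnn 1, hnn 2, hnn 3, hnn 4, hnn 5, hnn 10]

/-- In a `(24, 8, 12)`-code of size `2576` any two words meet in an even number of positions. -/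
theorem even_card_inter_of_card_eq (C : Finset (Finset (Fin 24))) (hC : ∀ A ∈ C, #A = 12)
    (hd : ∀ A ∈ C, ∀ B ∈ C, A ≠ B → #(A ∩ B) ≤ 8) (hcard : #C = 2576) :
    ∀ A ∈ C, ∀ B ∈ C, Even #(A ∩ B) := by
  intro A₀ hA₀ B₀ hB₀
  by_contra hodd
  have hlow := delsarteFunction_sum_ge C hC
  have hle : ∀ A ∈ C, ∀ B ∈ C, delsarteFunction #(A ∩ B) ≤
      if A = B then 2576 * 583896481962393600000 else 0 := by
    intro A hA B hB
    split_ifs with h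
    · rw [← h, Finset.inter_self, hC A hA, delsarteFunction_twelve]
    · exact delsarteFunction_nonpos _ (Nat.lt_succ_of_le (hd A hA B hB h))
  -- For 2576 words the bounds from below and above coincide, so one strictly negative term is
  -- contradictory.
  have hlt : ∑ A ∈ C, ∑ B ∈ C, delsarteFunction #(A ∩ B) <
      ∑ A ∈ C, ∑ B ∈ C, if A = B then (2576 * 583896481962393600000 : ℤ) else 0 := by
    refine Finset.sum_lt_sum (fun A hA => Finset.sum_le_sum (hle A hA)) ⟨A₀, hA₀, ?_⟩
    refine Finset.sum_lt_sum (hle A₀ hA₀) ⟨B₀, hB₀, ?_⟩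
    have hne : A₀ ≠ B₀ := by
      rintro rfl
      rw [Finset.inter_self, hC A₀ hA₀] at hodd
      exact hodd (by decide)
    rw [if_neg hne]
    exact delsarteFunction_neg_of_odd _ (Nat.lt_succ_of_le (hd A₀ hA₀ B₀ hB₀ hne))
      (Nat.not_even_iff.mp hodd)
  have hup : ∑ A ∈ C, ∑ B ∈ C, (if A = B then (2576 * 583896481962393600000 : ℤ) else 0) =
      2576 * (2576 * 583896481962393600000) := by
    rw [Finset.sum_congr rfl fun A hA => by rw [Finset.sum_ite_eq, if_pos hA]]
    rw [Finset.sum_const, hcard, nsmul_eq_mul]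
    norm_num
  rw [hcard] at hlow
  rw [hup] at hlt
  norm_num at hlow hlt
  linarith

open scoped symmDiff

/-! ### Binary words, their supports and the dot product -/

section Words

variable {n : ℕ}

/-- The binary word with support `A`. -/
def wordOf (A : Finset (Fin n)) : Fin n → ZMod 2 := fun i => if i ∈ A then 1 else 0

/-- The support of a binary word. -/
def wordSupport (x : Fin n → ZMod 2) : Finset (Fin n) := univ.filter (x · ≠ 0)

theorem wordOf_wordSupport (x : Fin n → ZMod 2) : wordOf (wordSupport x) = x := by
  ext i
  simp only [wordOf, wordSupport, mem_filter, mem_univ, true_and]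
  generalize x i = z
  revert z
  decide

theorem wordSupport_wordOf (A : Finset (Fin n)) : wordSupport (wordOf A) = A := by
  ext i
  simp [wordOf, wordSupport]

theorem wordOf_injective : Function.Injective (wordOf (n := n)) :=
  Function.LeftInverse.injective wordSupport_wordOf

theorem wordOf_symmDiff (A B : Finset (Fin n)) : wordOf (A ∆ B) = wordOf A + wordOf B := by
  ext i
  simp only [wordOf, mem_symmDiff, Pi.add_apply]
  by_cases h1 : i ∈ A <;> by_cases h2 : i ∈ B <;> simp [h1, h2]
  decide

theorem hammingNorm_wordOf (A : Finset (Fin n)) : hammingNorm (wordOf A) = #A := by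
  conv_rhs => rw [← wordSupport_wordOf A]
  rfl

theorem card_symmDiff_add {α : Type*} [DecidableEq α] (A B : Finset α) :
    #(A ∆ B) + 2 * #(A ∩ B) = #A + #B := by
  have h1 := Finset.card_sdiff_add_card_inter A B
  have h2 := Finset.card_sdiff_add_card_inter B A
  rw [Finset.inter_comm B A] at h2
  have h3 : #(A ∆ B) = #(A \ B) + #(B \ A) :=
    Finset.card_union_of_disjoint disjoint_sdiff_sdiff
  omega

theorem hammingDist_wordOf (A B : Finset (Fin n)) :
    hammingDist (wordOf A) (wordOf B) = #(A ∆ B) := by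
  rw [← hammingNorm_wordOf, wordOf_symmDiff, hammingDist_eq_hammingNorm]
  congr 1
  ext i
  simp

theorem wordOf_dotProduct (A B : Finset (Fin n)) :
    wordOf A ⬝ᵥ wordOf B = (#(A ∩ B) : ZMod 2) := by
  simp only [dotProduct, wordOf, mul_ite, mul_one, mul_zero, ← ite_and]
  rw [Finset.sum_boole]
  congr 2
  ext i
  simp [and_comm]

/-- The dot product as a bilinear form on binary words. -/
def wordForm (n : ℕ) : LinearMap.BilinForm (ZMod 2) (Fin n → ZMod 2) :=
  dotProductBilin (ZMod 2) (ZMod 2)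

theorem wordForm_apply (x y : Fin n → ZMod 2) : wordForm n x y = x ⬝ᵥ y := rfl

theorem wordForm_isRefl : (wordForm n).IsRefl := fun x y h => by
  rw [wordForm_apply] at h ⊢
  rwa [dotProduct_comm]

theorem wordForm_nondegenerate : (wordForm n).Nondegenerate := by
  refine ⟨fun x h => ?_, fun x h => ?_⟩
  · exact dotProduct_eq_zero_iff.mp h
  · refine dotProduct_eq_zero_iff.mp fun y => ?_
    rw [dotProduct_comm]
    exact h y

end Words

/-! ### The self-dual code spanned by an optimal code -/

/-- The family of supports of the words of a linear binary code of length `24` that is doubly even,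
has minimum weight `8` and is self-dual; of the last property only those instances are recorded
that are needed to recognise the code. -/
structure IsGolayFamily (P : Finset (Fin 24) → Prop) : Prop where
  symmDiff_mem : ∀ {A B}, P A → P B → P (A ∆ B)
  even_card_inter : ∀ {A B}, P A → P B → Even #(A ∩ B)
  four_dvd : ∀ {A}, P A → 4 ∣ #A
  eight_le : ∀ {A}, P A → A ≠ ∅ → 8 ≤ #A
  univ_mem : P univ
  exists_inter_eq : ∀ {L}, P L → #L = 12 → ∀ {i j}, i ∈ L → j ∈ L → i ≠ j →
    ∃ A, P A ∧ A ∩ L = {i, j}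

section Span

variable {C : Finset (Finset (Fin 24))}

/-- The linear code spanned by the words with supports in `C`. -/
def wordSpan (C : Finset (Finset (Fin 24))) : Submodule (ZMod 2) (Fin 24 → ZMod 2) :=
  Submodule.span (ZMod 2) (wordOf '' (C : Set (Finset (Fin 24))))

theorem wordSpan_le_orthogonal (he : ∀ A ∈ C, ∀ B ∈ C, Even #(A ∩ B)) :
    wordSpan C ≤ (wordForm 24).orthogonal (wordSpan C) := by
  rw [wordSpan, Submodule.span_le]
  rintro _ ⟨A, hA, rfl⟩
  rw [SetLike.mem_coe, LinearMap.BilinForm.mem_orthogonal_iff]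
  intro y hy
  induction hy using Submodule.span_induction with
  | mem x h =>
    obtain ⟨B, hB, rfl⟩ := h
    rw [wordForm_apply, wordOf_dotProduct]
    exact (ZMod.natCast_eq_zero_iff_even).mpr (he B hB A hA)
  | zero => simp
  | add x y _ _ h1 h2 =>
    simp [h1, h2]
  | smul a x _ h =>
    simp [h]

theorem even_card_inter_of_mem_wordSpan (he : ∀ A ∈ C, ∀ B ∈ C, Even #(A ∩ B))
    {A B : Finset (Fin 24)} (hA : wordOf A ∈ wordSpan C) (hB : wordOf B ∈ wordSpan C) :
    Even #(A ∩ B) := by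
  have := (LinearMap.BilinForm.mem_orthogonal_iff.mp (wordSpan_le_orthogonal he hB)) _ hA
  rw [wordForm_apply, wordOf_dotProduct] at this
  exact (ZMod.natCast_eq_zero_iff_even).mp this

/-- Since |A ∆ B| = |A| + |B| - 2|A ∩ B| and intersections are even, divisibility by 4 passes from
the generators to sums. -/
theorem four_dvd_of_mem_wordSpan (hC : ∀ A ∈ C, #A = 12)
    (he : ∀ A ∈ C, ∀ B ∈ C, Even #(A ∩ B)) {A : Finset (Fin 24)} (hA : wordOf A ∈ wordSpan C) :
    4 ∣ #A := by
  suffices h : ∀ x ∈ wordSpan C, 4 ∣ #(wordSupport x) by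
    simpa [wordSupport_wordOf] using h _ hA
  intro x hx
  have hx' := hx
  rw [wordSpan] at hx'
  induction hx' using Submodule.span_induction with
  | mem x h =>
    obtain ⟨B, hB, rfl⟩ := h
    rw [wordSupport_wordOf, hC B hB]
    decide
  | zero => simp [wordSupport]
  | add x y hx0 hy0 h1 h2 =>
    have h1 := h1 hx0
    have h2 := h2 hy0
    have h3 := even_card_inter_of_mem_wordSpan he (A := wordSupport x) (B := wordSupport y)
      (by rwa [wordOf_wordSupport]) (by rwa [wordOf_wordSupport])
    have h4 := card_symmDiff_add (wordSupport x) (wordSupport y)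
    have h5 : wordSupport (x + y) = wordSupport x ∆ wordSupport y := by
      apply wordOf_injective
      rw [wordOf_symmDiff, wordOf_wordSupport, wordOf_wordSupport, wordOf_wordSupport]
    rw [h5]
    obtain ⟨m, hm⟩ := h3
    omega
  | smul a x hx0 h =>
    have h := h hx0
    have : a = 0 ∨ a = 1 := (by decide : ∀ b : ZMod 2, b = 0 ∨ b = 1) a
    rcases this with rfl | rfl
    · simp [wordSupport]
    · rwa [one_smul]

theorem card_le_natCard_wordSpan (S : Finset (Finset (Fin 24)))
    (hS : ∀ A ∈ S, wordOf A ∈ wordSpan C) : #S ≤ Nat.card (wordSpan C) := by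
  rw [← Nat.card_eq_finsetCard]
  exact Nat.card_le_card_of_injective
    (fun A : S => (⟨wordOf A.1, hS A.1 A.2⟩ : wordSpan C))
    fun A B h => Subtype.ext (wordOf_injective (congrArg Subtype.val h))

/-- Self-orthogonality bounds the dimension by 12; 2576 > 2^11 excludes anything smaller. -/
theorem finrank_wordSpan (he : ∀ A ∈ C, ∀ B ∈ C, Even #(A ∩ B)) (hcard : #C = 2576) :
    Module.finrank (ZMod 2) (wordSpan C) = 12 := by
  have h1 := Submodule.finrank_mono (wordSpan_le_orthogonal he)
  rw [LinearMap.BilinForm.finrank_orthogonal wordForm_nondegenerate, Module.finrank_fin_fun] at h1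
  have h2 : #C ≤ Nat.card (wordSpan C) :=
    card_le_natCard_wordSpan C fun A hA => Submodule.subset_span ⟨A, hA, rfl⟩
  rw [Module.natCard_eq_pow_finrank (K := ZMod 2), Nat.card_zmod, hcard] at h2
  have h3 : ¬ Module.finrank (ZMod 2) (wordSpan C) ≤ 11 := fun h => by
    have := Nat.pow_le_pow_right (n := 2) (by norm_num) h
    omega
  omega

theorem wordSpan_orthogonal (he : ∀ A ∈ C, ∀ B ∈ C, Even #(A ∩ B)) (hcard : #C = 2576) :
    (wordForm 24).orthogonal (wordSpan C) = wordSpan C := by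
  refine (Submodule.eq_of_le_of_finrank_le (wordSpan_le_orthogonal he) ?_).symm
  rw [LinearMap.BilinForm.finrank_orthogonal wordForm_nondegenerate, finrank_wordSpan he hcard,
    Module.finrank_fin_fun]

theorem wordOf_mem_wordSpan_iff (he : ∀ A ∈ C, ∀ B ∈ C, Even #(A ∩ B)) (hcard : #C = 2576)
    {A : Finset (Fin 24)} :
    wordOf A ∈ wordSpan C ↔ ∀ B, wordOf B ∈ wordSpan C → Even #(A ∩ B) := by
  refine ⟨fun hA B hB => even_card_inter_of_mem_wordSpan he hA hB, fun h => ?_⟩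
  rw [← wordSpan_orthogonal he hcard, LinearMap.BilinForm.mem_orthogonal_iff]
  intro y hy
  rw [← wordOf_wordSupport y] at hy ⊢
  rw [wordForm_apply, wordOf_dotProduct, Finset.inter_comm]
  exact (ZMod.natCast_eq_zero_iff_even).mpr (h _ hy)

/-- Only weight 4 has to be excluded. Translating the code by such a word moves every codeword to
distance 4, hence out of the code, and 5152 words do not fit into a space of 4096. -/
theorem eight_le_card_of_mem_wordSpan (hC : ∀ A ∈ C, #A = 12)
    (hd : ∀ A ∈ C, ∀ B ∈ C, A ≠ B → #(A ∩ B) ≤ 8)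
    (he : ∀ A ∈ C, ∀ B ∈ C, Even #(A ∩ B)) (hcard : #C = 2576)
    {X : Finset (Fin 24)} (hX : wordOf X ∈ wordSpan C) (hne : X ≠ ∅) : 8 ≤ #X := by
  by_contra hlt
  have hpos := Finset.card_pos.mpr (Finset.nonempty_iff_ne_empty.mpr hne)
  have h4 : #X = 4 := by
    have := four_dvd_of_mem_wordSpan hC he hX
    omega
  classical
  set E := C.image (fun A => A ∆ X) with hE
  have hEcard : #E = 2576 := by
    rw [hE, Finset.card_image_of_injective _ (symmDiff_left_injective X), hcard]
  have hdisj : Disjoint C E := by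
    rw [Finset.disjoint_left]
    intro A hA hAE
    obtain ⟨B, hB, rfl⟩ := Finset.mem_image.mp hAE
    have hne' : B ∆ X ≠ B := fun h => hne (symmDiff_eq_left.mp h)
    have h1 := hd _ hA _ hB hne'
    have h2 := card_symmDiff_add (B ∆ X) B
    rw [symmDiff_symmDiff_self', hC _ hA, hC _ hB, h4] at h2
    omega
  have hsub : ∀ A ∈ C ∪ E, wordOf A ∈ wordSpan C := by
    intro A hA
    rcases Finset.mem_union.mp hA with hA | hA
    · exact Submodule.subset_span ⟨A, hA, rfl⟩
    · obtain ⟨B, hB, rfl⟩ := Finset.mem_image.mp hA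
      rw [wordOf_symmDiff]
      exact Submodule.add_mem _ (Submodule.subset_span ⟨B, hB, rfl⟩) hX
  have hcount : #(C ∪ E) ≤ Nat.card (wordSpan C) :=
    card_le_natCard_wordSpan (C ∪ E) hsub
  rw [Module.natCard_eq_pow_finrank (K := ZMod 2), Nat.card_zmod, finrank_wordSpan he hcard,
    Finset.card_union_of_disjoint hdisj, hcard, hEcard] at hcount
  norm_num at hcount

/-- The linear span of a `(24, 8, 12)`-code of size `2576`. -/
theorem isGolayFamily_wordSpan (hC : ∀ A ∈ C, #A = 12)
    (hd : ∀ A ∈ C, ∀ B ∈ C, A ≠ B → #(A ∩ B) ≤ 8) (hcard : #C = 2576) :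
    IsGolayFamily (fun A => wordOf A ∈ wordSpan C) := by
  have he := even_card_inter_of_card_eq C hC hd hcard
  have hsymm : ∀ {A B : Finset (Fin 24)}, wordOf A ∈ wordSpan C → wordOf B ∈ wordSpan C →
      wordOf (A ∆ B) ∈ wordSpan C := fun hA hB => by
    rw [wordOf_symmDiff]
    exact Submodule.add_mem _ hA hB
  have h8 : ∀ {A : Finset (Fin 24)}, wordOf A ∈ wordSpan C → A ≠ ∅ → 8 ≤ #A :=
    eight_le_card_of_mem_wordSpan hC hd he hcard
  have h4 : ∀ {A : Finset (Fin 24)}, wordOf A ∈ wordSpan C → 4 ∣ #A :=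
    four_dvd_of_mem_wordSpan hC he
  refine ⟨hsymm, even_card_inter_of_mem_wordSpan he, h4, h8, ?_, ?_⟩
  · rw [wordOf_mem_wordSpan_iff he hcard]
    intro B hB
    rw [Finset.univ_inter]
    exact even_iff_two_dvd.mpr (dvd_trans (by decide) (h4 hB))
  · intro L hL hLcard i j hi hj hij
    set F : Submodule (ZMod 2) (Fin 24 → ZMod 2) :=
      LinearMap.ker (LinearMap.funLeft (ZMod 2) (ZMod 2) (Subtype.val : L → Fin 24)) with hF
    have hFmem : ∀ x, x ∈ F ↔ ∀ k ∈ L, x k = 0 := fun x => by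
      rw [hF, LinearMap.mem_ker, funext_iff]
      simp [LinearMap.funLeft_apply]
    -- Duality: with `F` the words vanishing on `L`, a word lies in the span plus `F` as soon as it
    -- is orthogonal to every span word supported inside `L`. These are only 0 and `L`, both of
    -- which meet a pair in `L` evenly.
    have hmem : wordOf {i, j} ∈ wordSpan C ⊔ F := by
      rw [← LinearMap.BilinForm.orthogonal_orthogonal wordForm_nondegenerate wordForm_isRefl
        (wordSpan C ⊔ F), LinearMap.BilinForm.mem_orthogonal_iff]
      intro z hz
      rw [LinearMap.BilinForm.mem_orthogonal_iff] at hz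
      have hzC : z ∈ wordSpan C := by
        rw [← wordSpan_orthogonal he hcard, LinearMap.BilinForm.mem_orthogonal_iff]
        exact fun y hy => hz y (Submodule.mem_sup_left hy)
      have hzL : wordSupport z ⊆ L := by
        intro k hk
        by_contra hkL
        have h1 := hz (Pi.single k 1) (Submodule.mem_sup_right ((hFmem _).mpr fun l hl => by
          rw [Pi.single_eq_of_ne]
          rintro rfl
          exact hkL hl))
        rw [wordForm_apply, single_dotProduct, one_mul] at h1
        exact (Finset.mem_filter.mp hk).2 h1
      rw [← wordOf_wordSupport z, wordForm_apply,
        wordOf_dotProduct, ZMod.natCast_eq_zero_iff_even]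
      rw [← wordOf_wordSupport z] at hzC
      -- Otherwise `L` would split into two nonempty span words, of weight at least 8 each, although
      -- it has only 12 positions.
      have hcase : wordSupport z = ∅ ∨ L ∆ wordSupport z = ∅ := by
        by_contra! hcon
        have h1 := h8 hzC (Finset.nonempty_iff_ne_empty.mp hcon.1)
        have h2 := h8 (hsymm hL hzC) (Finset.nonempty_iff_ne_empty.mp hcon.2)
        have h3 := card_symmDiff_add L (wordSupport z)
        rw [Finset.inter_eq_right.mpr hzL] at h3
        omega
      rcases hcase with h | h
      · simp [h]
      · rw [← symmDiff_eq_bot.mp h, Finset.inter_eq_right.mpr, Finset.card_pair hij]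
        · decide
        · intro k hk
          rcases Finset.mem_insert.mp hk with rfl | hk
          · exact hi
          · rwa [Finset.mem_singleton.mp hk]
    obtain ⟨x, hx, y, hy, hxy⟩ := Submodule.mem_sup.mp hmem
    refine ⟨wordSupport x, by rwa [wordOf_wordSupport], ?_⟩
    ext k
    rw [Finset.mem_inter]
    have h1 : ∀ k ∈ L, (k ∈ wordSupport x ↔ k ∈ ({i, j} : Finset (Fin 24))) := fun k hk => by
      have := congrFun hxy k
      rw [Pi.add_apply, (hFmem y).mp hy k hk, add_zero] at this
      conv_rhs => rw [← wordSupport_wordOf {i, j}]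
      simp only [wordSupport, Finset.mem_filter, this]
    constructor
    · rintro ⟨h2, h3⟩
      exact (h1 k h3).mp h2
    · intro h2
      have h3 : k ∈ L := by
        rcases Finset.mem_insert.mp h2 with rfl | hk
        · exact hi
        · rwa [Finset.mem_singleton.mp hk]
      exact ⟨(h1 k h3).mpr h2, h3⟩

end Span

/-! ### Uniqueness of the 2-(11,5,2) design -/

/-- The edges of the complete graph on `Fin 5`: the pair `(s, i)` stands for the edge joining `i`
and `i + 1 + s`. -/
def edgeEnd (p : Fin 2 × Fin 5) : Fin 5 := p.2 + if p.1 = 0 then 1 else 2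

/-- The edge joining two vertices of the complete graph on `Fin 5`. -/
def edgeOf (a b : Fin 5) : Fin 2 × Fin 5 :=
  if b = a + 1 then (0, a) else if a = b + 1 then (0, b) else if b = a + 2 then (1, a) else (1, b)

/-- The five pentagons in the complete graph on `Fin 5` that share exactly two edges with the
standard one. -/
def skewPentagon (k : Fin 5) (p : Fin 2 × Fin 5) : Bool :=
  if p.1 = 0 then p.2 = k ∨ p.2 = k + 2 else p.2 = k + 2 ∨ p.2 = k + 3 ∨ p.2 = k + 4

/-- The incidence matrix of the biplane with `11` points: the first block consists of the vertices
of the complete graph on `Fin 5`, the other blocks are the edges of this graph, and the other points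
are the standard pentagon and the five pentagons sharing two edges with it. -/
def pentagonBiplane : Option (Fin 2 × Fin 5) → Fin 5 ⊕ Option (Fin 5) → Bool
  | none, .inl _ => true
  | none, .inr _ => false
  | some p, .inl a => a = p.2 ∨ a = edgeEnd p
  | some p, .inr none => p.1 = 0
  | some p, .inr (some k) => skewPentagon k p

theorem edgeOf_spec : ∀ a b : Fin 5, a ≠ b →
    ((edgeOf a b).2 = a ∧ edgeEnd (edgeOf a b) = b) ∨
      ((edgeOf a b).2 = b ∧ edgeEnd (edgeOf a b) = a) := by decide

theorem ne_edgeEnd : ∀ p : Fin 2 × Fin 5, p.2 ≠ edgeEnd p := by decide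

theorem edge_ext : ∀ p q : Fin 2 × Fin 5,
    (∀ a, (a = p.2 ∨ a = edgeEnd p) ↔ (a = q.2 ∨ a = edgeEnd q)) → p = q := by decide

-- Exhaustion over the 2^10 graphs on five vertices; `g` and `h` mark the edges between vertices at
-- cyclic distance 1 and 2.
set_option maxRecDepth 100000 in
theorem exists_perm_of_regular_aux : ∀ g h : Fin 5 → Bool,
    (∀ a, #{p : Fin 2 × Fin 5 | (if p.1 = 0 then g p.2 else h p.2) = true ∧
      (a = p.2 ∨ a = edgeEnd p)} = 2) →
    ∃ π : Equiv.Perm (Fin 5), ∀ p : Fin 2 × Fin 5,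
      (if (edgeOf (π p.2) (π (edgeEnd p))).1 = 0 then g (edgeOf (π p.2) (π (edgeEnd p))).2
        else h (edgeOf (π p.2) (π (edgeEnd p))).2) = decide (p.1 = 0) := by
  decide +kernel

set_option maxRecDepth 100000 in
theorem exists_skewPentagon_aux : ∀ g h : Fin 5 → Bool,
    (∀ a, #{p : Fin 2 × Fin 5 | (if p.1 = 0 then g p.2 else h p.2) = true ∧
      (a = p.2 ∨ a = edgeEnd p)} = 2) →
    #{p : Fin 2 × Fin 5 | (if p.1 = 0 then g p.2 else h p.2) = true ∧ p.1 = 0} = 2 →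
    ∃ k, ∀ p : Fin 2 × Fin 5, (if p.1 = 0 then g p.2 else h p.2) = skewPentagon k p := by
  decide +kernel

theorem eq_ite_fst (m : Fin 2 × Fin 5 → Bool) (p : Fin 2 × Fin 5) :
    (if p.1 = 0 then m (0, p.2) else m (1, p.2)) = m p := by
  obtain ⟨s, i⟩ := p
  fin_cases s <;> rfl

/-- A two-regular graph on five vertices is a pentagon. -/
theorem exists_perm_of_regular (m : Fin 2 × Fin 5 → Bool)
    (hm : ∀ a, #{p : Fin 2 × Fin 5 | m p = true ∧ (a = p.2 ∨ a = edgeEnd p)} = 2) :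
    ∃ π : Equiv.Perm (Fin 5), ∀ p : Fin 2 × Fin 5,
      m (edgeOf (π p.2) (π (edgeEnd p))) = decide (p.1 = 0) := by
  have := exists_perm_of_regular_aux (fun i => m (0, i)) (fun i => m (1, i))
  simp only [eq_ite_fst] at this
  exact this hm

theorem exists_skewPentagon (m : Fin 2 × Fin 5 → Bool)
    (hm : ∀ a, #{p : Fin 2 × Fin 5 | m p = true ∧ (a = p.2 ∨ a = edgeEnd p)} = 2)
    (h0 : #{p : Fin 2 × Fin 5 | m p = true ∧ p.1 = 0} = 2) :
    ∃ k, ∀ p : Fin 2 × Fin 5, m p = skewPentagon k p := by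
  have := exists_skewPentagon_aux (fun i => m (0, i)) (fun i => m (1, i))
  simp only [eq_ite_fst] at this
  exact this hm h0

theorem mem_pair_of_card_eq_two {α : Type*} [DecidableEq α] {s : Finset α} (hs : #s = 2) {a b : α}
    (ha : a ∈ s) (hb : b ∈ s) (hab : a ≠ b) {c : α} (hc : c ∈ s) : c = a ∨ c = b := by
  have hsub : ({a, b} : Finset α) ⊆ s := by
    intro x hx
    rcases Finset.mem_insert.mp hx with rfl | hx
    · exact ha
    · rwa [Finset.mem_singleton.mp hx]
  have := Finset.eq_of_subset_of_card_le hsub (by rw [hs, Finset.card_pair hab])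
  rw [← this] at hc
  simpa using hc

section EdgeLabelling

variable {X Y : Type*} {inc : X → Y → Prop}

/-- A labelling of the points of a block `x₀` of a biplane by `Fin 5`, and the induced labelling of
the other blocks by the edges of the complete graph on `Fin 5`. -/
structure IsEdgeLabelling (inc : X → Y → Prop) (x₀ : X) (w : Fin 5 → Y) (E : Fin 5 → Fin 5 → X) :
    Prop where
  inc_vertex : ∀ a, inc x₀ (w a)
  exists_vertex : ∀ y, inc x₀ y → ∃ a, w a = y
  injective : Function.Injective w
  ne : ∀ a b, a ≠ b → E a b ≠ x₀
  inc_iff : ∀ a b c, a ≠ b → (inc (E a b) (w c) ↔ c = a ∨ c = b)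
  symm : ∀ a b, E a b = E b a
  exists_edge : ∀ x, x ≠ x₀ → ∃ a b, a ≠ b ∧ E a b = x

namespace IsEdgeLabelling

variable {x₀ : X} {w : Fin 5 → Y} {E : Fin 5 → Fin 5 → X}

theorem comp (h : IsEdgeLabelling inc x₀ w E) (π : Equiv.Perm (Fin 5)) :
    IsEdgeLabelling inc x₀ (fun a => w (π a)) (fun a b => E (π a) (π b)) where
  inc_vertex a := h.inc_vertex _
  exists_vertex y hy := by
    obtain ⟨a, rfl⟩ := h.exists_vertex y hy
    exact ⟨π.symm a, by simp⟩
  injective := h.injective.comp π.injective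
  ne a b hab := h.ne _ _ (π.injective.ne hab)
  inc_iff a b c hab := by
    rw [h.inc_iff _ _ _ (π.injective.ne hab), π.injective.eq_iff, π.injective.eq_iff]
  symm a b := h.symm _ _
  exists_edge x hx := by
    obtain ⟨a, b, hab, rfl⟩ := h.exists_edge x hx
    exact ⟨π.symm a, π.symm b, π.symm.injective.ne hab, by simp⟩

/-- The block labelled by an edge. -/
theorem edge_eq (h : IsEdgeLabelling inc x₀ w E) {a b : Fin 5} (hab : a ≠ b) :
    E a b = E (edgeOf a b).2 (edgeEnd (edgeOf a b)) := by
  rcases edgeOf_spec a b hab with ⟨h1, h2⟩ | ⟨h1, h2⟩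
  · rw [h1, h2]
  · rw [h1, h2, h.symm]

theorem edge_injective (h : IsEdgeLabelling inc x₀ w E) :
    Function.Injective fun p : Fin 2 × Fin 5 => E p.2 (edgeEnd p) := fun p q hpq => by
  refine edge_ext p q fun a => ?_
  rw [← h.inc_iff _ _ a (ne_edgeEnd p), ← h.inc_iff _ _ a (ne_edgeEnd q)]
  exact iff_of_eq (congrArg (fun x => inc x (w a)) hpq)

theorem card_filter_edge [Fintype X] [DecidableEq X] (h : IsEdgeLabelling inc x₀ w E) (q : X → Prop)
    [DecidablePred q]
    (hq : ¬ q x₀) : #{p : Fin 2 × Fin 5 | q (E p.2 (edgeEnd p))} = #{x | q x} := by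
  rw [← Finset.card_image_of_injective _ h.edge_injective]
  congr 1
  ext x
  simp only [Finset.mem_image, Finset.mem_filter, Finset.mem_univ, true_and]
  constructor
  · rintro ⟨p, hp, rfl⟩
    exact hp
  · intro hx
    obtain ⟨a, b, hab, rfl⟩ := h.exists_edge x (fun hh => hq (hh ▸ hx))
    refine ⟨edgeOf a b, ?_, (h.edge_eq hab).symm⟩
    rwa [← h.edge_eq hab]

end IsEdgeLabelling

end EdgeLabelling

section Biplane

variable {X Y : Type*} [Fintype X] [Fintype Y] [DecidableEq X]

/-- The incidence relation of a `2-(11, 5, 2)` design. -/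
structure IsBiplane (inc : X → Y → Prop) [DecidableRel inc] : Prop where
  card_left : Fintype.card X = 11
  card_right : Fintype.card Y = 11
  card_row : ∀ x, #{y | inc x y} = 5
  card_row_inter : ∀ x x', x ≠ x' → #{y | inc x y ∧ inc x' y} = 2
  card_col : ∀ y, #{x | inc x y} = 5
  card_col_inter : ∀ y y', y ≠ y' → #{x | inc x y ∧ inc x y'} = 2

variable {inc : X → Y → Prop} [DecidableRel inc]

namespace IsEdgeLabelling

variable {x₀ : X} {w : Fin 5 → Y} {E : Fin 5 → Fin 5 → X}

/-- A point off `x₀` shares two blocks with each vertex, so the edges labelling its blocks form a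
two-regular graph. -/
theorem regular (h : IsEdgeLabelling inc x₀ w E) (hb : IsBiplane inc) {c : Y} (hc : ¬ inc x₀ c)
    (a : Fin 5) :
    #{p : Fin 2 × Fin 5 | decide (inc (E p.2 (edgeEnd p)) c) = true ∧
      (a = p.2 ∨ a = edgeEnd p)} = 2 := by
  have hne : c ≠ w a := fun hh => hc (hh ▸ h.inc_vertex a)
  refine Eq.trans ?_ ((h.card_filter_edge _ (fun hh => hc hh.1)).trans
    (hb.card_col_inter _ _ hne))
  congr 1
  ext p
  simp only [Finset.mem_filter, h.inc_iff _ _ _ (ne_edgeEnd p), decide_eq_true_eq]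

end IsEdgeLabelling

variable [DecidableEq Y]

/-- Two points of `x₀` lie on exactly one further block, and every further block meets `x₀` in two
points; so the other blocks correspond to the edges on the five points of `x₀`. -/
theorem IsBiplane.exists_isEdgeLabelling (h : IsBiplane inc) (x₀ : X) :
    ∃ w E, IsEdgeLabelling inc x₀ w E := by
  obtain ⟨e⟩ : Nonempty (Fin 5 ≃ {y // inc x₀ y}) := by
    rw [← Fintype.card_eq, Fintype.card_fin, Fintype.card_subtype, h.card_row]
  have hedge : ∀ a b : Fin 5, a ≠ b → ∃ x, x ≠ x₀ ∧ inc x (e a) ∧ inc x (e b) := by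
    intro a b hab
    have hne : (e a : Y) ≠ e b := fun hh => hab (e.injective (Subtype.ext hh))
    obtain ⟨x, hx, hx0⟩ := Finset.exists_mem_ne (by rw [h.card_col_inter _ _ hne]; decide) x₀
    rw [Finset.mem_filter] at hx
    exact ⟨x, hx0, hx.2⟩
  have : Nonempty X := ⟨x₀⟩
  choose! E hE1 hE2 hE3 using hedge
  have hrow : ∀ a b, a ≠ b → ∀ x, x ≠ x₀ → inc x (e a) → inc x (e b) → x = E a b := by
    intro a b hab x hx h1 h2
    have hne : (e a : Y) ≠ e b := fun hh => hab (e.injective (Subtype.ext hh))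
    have := mem_pair_of_card_eq_two (h.card_col_inter _ _ hne)
      (a := x₀) (b := E a b) (c := x) (by simp [(e a).2, (e b).2])
      (by simp [hE2 a b hab, hE3 a b hab]) (hE1 a b hab).symm (by simp [h1, h2])
    exact this.resolve_left hx
  refine ⟨fun a => e a, fun a b => if a = b then x₀ else E a b, fun a => (e a).2,
    fun y hy => ⟨e.symm ⟨y, hy⟩, by simp⟩, fun a b hab => e.injective (Subtype.ext hab),
    fun a b hab => by simpa [hab] using hE1 a b hab, fun a b c hab => ?_, fun a b => ?_,
    fun x hx => ?_⟩
  · simp only [hab, if_false]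
    constructor
    · intro hc
      have hne : (e a : Y) ≠ e b := fun hh => hab (e.injective (Subtype.ext hh))
      rcases mem_pair_of_card_eq_two (h.card_row_inter _ _ (hE1 a b hab))
        (a := (e a : Y)) (b := e b) (c := e c) (by simp [hE2 a b hab, (e a).2])
        (by simp [hE3 a b hab, (e b).2]) hne (by simp [hc, (e c).2]) with h1 | h1
      · exact Or.inl (e.injective (Subtype.ext h1))
      · exact Or.inr (e.injective (Subtype.ext h1))
    · rintro (rfl | rfl)
      · exact hE2 _ _ hab
      · exact hE3 _ _ hab
  · by_cases hab : a = b
    · simp [hab]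
    · simp only [hab, Ne.symm hab, if_false]
      exact hrow b a (Ne.symm hab) _ (hE1 a b hab) (hE3 a b hab) (hE2 a b hab)
  · obtain ⟨y, z, hyz, hs⟩ := Finset.card_eq_two.mp (h.card_row_inter _ _ hx)
    have hy : y ∈ ({y, z} : Finset Y) := by simp
    have hz : z ∈ ({y, z} : Finset Y) := by simp
    rw [← hs, Finset.mem_filter] at hy hz
    have hne : e.symm ⟨y, hy.2.2⟩ ≠ e.symm ⟨z, hz.2.2⟩ := fun hh =>
      hyz (congrArg Subtype.val (e.symm.injective hh))
    refine ⟨_, _, hne, ?_⟩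
    simp only [hne, if_false]
    exact (hrow _ _ hne x hx (by simpa using hy.2.1) (by simpa using hz.2.1)).symm

/-- Any two `2-(11, 5, 2)` designs are isomorphic. -/
theorem IsBiplane.exists_equiv (hb : IsBiplane inc) :
    ∃ (f : Option (Fin 2 × Fin 5) ≃ X) (g : Fin 5 ⊕ Option (Fin 5) ≃ Y),
      ∀ i j, inc (f i) (g j) ↔ pentagonBiplane i j = true := by
  have hne : Nonempty X := Fintype.card_pos_iff.mp (by rw [hb.card_left]; decide)
  obtain ⟨x₀⟩ := hne
  obtain ⟨c₀, hc₀⟩ : ∃ c, ¬ inc x₀ c := by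
    by_contra! hall
    have h1 := hb.card_row x₀
    rw [Finset.filter_true_of_mem fun y _ => hall y, Finset.card_univ, hb.card_right] at h1
    omega
  -- Relabelling the vertices turns the pentagon of `c₀` into the standard one.
  obtain ⟨w, E, h, hpent⟩ : ∃ w E, IsEdgeLabelling inc x₀ w E ∧
      ∀ p : Fin 2 × Fin 5, inc (E p.2 (edgeEnd p)) c₀ ↔ p.1 = 0 := by
    obtain ⟨w, E, h⟩ := hb.exists_isEdgeLabelling x₀
    obtain ⟨π, hπ⟩ := exists_perm_of_regular
      (fun p => decide (inc (E p.2 (edgeEnd p)) c₀)) (h.regular hb hc₀)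
    refine ⟨_, _, h.comp π, fun p => ?_⟩
    have := hπ p
    rw [← h.edge_eq (π.injective.ne (ne_edgeEnd p))] at this
    simpa using this
  have hskew : ∀ c : {c // ¬ inc x₀ c ∧ c ≠ c₀}, ∃ k, ∀ p : Fin 2 × Fin 5,
      inc (E p.2 (edgeEnd p)) c.1 ↔ skewPentagon k p = true := by
    rintro ⟨c, hc, hcc⟩
    obtain ⟨k, hk⟩ := exists_skewPentagon (fun p => decide (inc (E p.2 (edgeEnd p)) c))
      (h.regular hb hc) (by
        refine Eq.trans ?_ ((h.card_filter_edge _ (fun hh => hc hh.1)).trans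
          (hb.card_col_inter _ _ hcc))
        congr 1
        ext p
        simp only [Finset.mem_filter, hpent, decide_eq_true_eq])
    exact ⟨k, fun p => by rw [← hk p, decide_eq_true_eq]⟩
  choose κ hκ using hskew
  -- Two points with the same pentagon would share five blocks instead of two.
  have hκinj : Function.Injective κ := by
    rintro ⟨c, hc, hcc⟩ ⟨c', hc', hcc'⟩ heq
    by_contra hne
    have hne : c ≠ c' := fun hh => hne (Subtype.ext hh)
    have h1 := hb.card_col_inter _ _ hne
    rw [← h.card_filter_edge _ (fun hh => hc hh.1)] at h1
    have h2 := hb.card_col c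
    rw [← h.card_filter_edge _ hc] at h2
    have h3 : ∀ p : Fin 2 × Fin 5, inc (E p.2 (edgeEnd p)) c ∧ inc (E p.2 (edgeEnd p)) c' ↔
        inc (E p.2 (edgeEnd p)) c := fun p => by
      rw [hκ ⟨c, hc, hcc⟩ p, hκ ⟨c', hc', hcc'⟩ p, heq, and_self]
    simp only [h3] at h1
    omega
  have hcardc : Fintype.card {c // ¬ inc x₀ c ∧ c ≠ c₀} = 5 := by
    have h1 := hb.card_row x₀
    have h2 := Finset.card_filter_add_card_filter_not (s := (univ : Finset Y)) (fun y => inc x₀ y)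
    rw [h1, Finset.card_univ, hb.card_right] at h2
    have h3 : ({c | ¬ inc x₀ c ∧ c ≠ c₀} : Finset Y) =
        ({c | ¬ inc x₀ c} : Finset Y).erase c₀ := by
      ext c
      simp [and_comm]
    rw [Fintype.card_subtype, h3, Finset.card_erase_of_mem (by simp [hc₀])]
    omega
  -- There remain 11 - 5 - 1 = 5 points, as many as skew pentagons.
  have hκbij : Function.Bijective κ :=
    (Fintype.bijective_iff_injective_and_card κ).mpr ⟨hκinj, by simp [hcardc]⟩
  set κ' := Equiv.ofBijective κ hκbij with hκ'
  have hκs : ∀ k, ∀ p : Fin 2 × Fin 5,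
      inc (E p.2 (edgeEnd p)) (κ'.symm k).1 ↔ skewPentagon k p = true := fun k p => by
    rw [hκ (κ'.symm k) p]
    have : κ (κ'.symm k) = k := κ'.apply_symm_apply k
    rw [this]
  let f : Option (Fin 2 × Fin 5) → X := fun i => i.elim x₀ fun p => E p.2 (edgeEnd p)
  let g : Fin 5 ⊕ Option (Fin 5) → Y :=
    Sum.elim w fun j => j.elim c₀ fun k => (κ'.symm k).1
  have hf : Function.Bijective f := by
    refine (Fintype.bijective_iff_surjective_and_card f).mpr ⟨fun x => ?_, by
      rw [hb.card_left]; rfl⟩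
    by_cases hx : x = x₀
    · exact ⟨none, hx.symm⟩
    · obtain ⟨a, b, hab, rfl⟩ := h.exists_edge x hx
      exact ⟨some (edgeOf a b), (h.edge_eq hab).symm⟩
  have hg : Function.Bijective g := by
    refine (Fintype.bijective_iff_surjective_and_card g).mpr ⟨fun y => ?_, by
      rw [hb.card_right]; rfl⟩
    by_cases hy : inc x₀ y
    · obtain ⟨a, rfl⟩ := h.exists_vertex y hy
      exact ⟨.inl a, rfl⟩
    · by_cases hy' : y = c₀
      · exact ⟨.inr none, hy'.symm⟩
      · exact ⟨.inr (some (κ' ⟨y, hy, hy'⟩)), by simp [g]⟩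
  refine ⟨Equiv.ofBijective f hf, Equiv.ofBijective g hg, ?_⟩
  rintro (_ | p) (a | _ | k)
  · simp [f, g, pentagonBiplane, h.inc_vertex]
  · simp [f, g, pentagonBiplane, hc₀]
  · simpa [f, g, pentagonBiplane] using (κ'.symm k).2.1
  · simp [f, g, pentagonBiplane, h.inc_iff _ _ _ (ne_edgeEnd p)]
  · simp [f, g, pentagonBiplane, hpent]
  · simp [f, g, pentagonBiplane, hκs]

end Biplane

/-! ### The biplane attached to a dodecad -/

namespace IsGolayFamily

variable {P : Finset (Fin 24) → Prop}

theorem compl_mem (hP : IsGolayFamily P) {L : Finset (Fin 24)} (hL : P L) : P Lᶜ := by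
  have := hP.symmDiff_mem hP.univ_mem hL
  rwa [← Finset.top_eq_univ, top_symmDiff] at this

theorem card_compl {L : Finset (Fin 24)} (hL : #L = 12) : #Lᶜ = 12 := by
  rw [Finset.card_compl, hL, Fintype.card_fin]

theorem card_eq_card_inter_add (A L : Finset (Fin 24)) : #A = #(A ∩ L) + #(A ∩ Lᶜ) := by
  have := Finset.card_sdiff_add_card_inter A L
  rw [Finset.sdiff_eq_inter_compl] at this
  omega

variable {L : Finset (Fin 24)}

/-- With x positions outside `L`, the weights 2 + x of `A` and 14 - x of `A ∆ Lᶜ` are both at least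
8, which forces x = 6. -/
theorem card_inter_compl (hP : IsGolayFamily P) (hL : P L) (hc : #L = 12) {A : Finset (Fin 24)}
    (hA : P A) {i j : Fin 24} (hij : i ≠ j) (hAL : A ∩ L = {i, j}) : #(A ∩ Lᶜ) = 6 := by
  have h1 := card_eq_card_inter_add A L
  rw [hAL, Finset.card_pair hij] at h1
  have h2 := hP.four_dvd hA
  have h3 := hP.eight_le hA (by
    rintro rfl
    simp at h1)
  have hB := hP.symmDiff_mem hA (hP.compl_mem hL)
  have h4 := card_symmDiff_add A Lᶜ
  rw [card_compl hc] at h4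
  have h5 : #(A ∩ Lᶜ) ≤ 12 := by
    rw [← card_compl hc]
    exact Finset.card_le_card Finset.inter_subset_right
  have h6 := hP.eight_le hB (by
    intro h
    rw [h, Finset.card_empty] at h4
    omega)
  omega

/-- Adding `Lᶜ` keeps the trace on `L` and switches membership of `v`. -/
theorem exists_inter_eq_mem (hP : IsGolayFamily P) (hL : P L) (hc : #L = 12) {u v j : Fin 24}
    (hu : u ∈ L) (hv : v ∈ Lᶜ) (hj : j ∈ L) (hne : u ≠ j) :
    ∃ A, P A ∧ A ∩ L = {u, j} ∧ v ∈ A := by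
  obtain ⟨A, hA, hAL⟩ := hP.exists_inter_eq hL hc hu hj hne
  by_cases hvA : v ∈ A
  · exact ⟨A, hA, hAL, hvA⟩
  · refine ⟨A ∆ Lᶜ, hP.symmDiff_mem hA (hP.compl_mem hL), ?_, ?_⟩
    · rw [← hAL]
      ext x
      simp only [mem_inter, mem_symmDiff, mem_compl]
      tauto
    · exact Finset.mem_symmDiff.mpr (Or.inr ⟨hv, hvA⟩)

theorem card_block (hP : IsGolayFamily P) (hL : P L) (hc : #L = 12) {u v j : Fin 24}
    (hv : v ∈ Lᶜ) (hne : u ≠ j) {A : Finset (Fin 24)} (hA : P A) (hAL : A ∩ L = {u, j})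
    (hvA : v ∈ A) : #((A ∩ Lᶜ).erase v) = 5 := by
  rw [Finset.card_erase_of_mem (Finset.mem_inter.mpr ⟨hvA, hv⟩),
    hP.card_inter_compl hL hc hA hne hAL]

/-- The sum `A ∆ A'` meets `L` in {j, j'}, so all three traces on `Lᶜ` have size 6. Hence the two
blocks share 3 positions, one of them `v`. -/
theorem card_block_inter (hP : IsGolayFamily P) (hL : P L) (hc : #L = 12) {u v j j' : Fin 24}
    (hv : v ∈ Lᶜ) (hne : u ≠ j) (hne' : u ≠ j') (hjj : j ≠ j') {A A' : Finset (Fin 24)}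
    (hA : P A) (hAL : A ∩ L = {u, j}) (hvA : v ∈ A)
    (hA' : P A') (hAL' : A' ∩ L = {u, j'}) (hvA' : v ∈ A') :
    #((A ∩ A' ∩ Lᶜ).erase v) = 2 := by
  have h1 := hP.card_inter_compl hL hc hA hne hAL
  have h2 := hP.card_inter_compl hL hc hA' hne' hAL'
  have h3 := hP.card_inter_compl hL hc (hP.symmDiff_mem hA hA') hjj (by
    rw [← Finset.inf_eq_inter, inf_symmDiff_distrib_right, Finset.inf_eq_inter,
      Finset.inf_eq_inter, hAL, hAL']
    ext x
    simp only [mem_symmDiff, mem_insert, mem_singleton]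
    constructor
    · tauto
    · rintro (rfl | rfl)
      · exact Or.inl ⟨Or.inr rfl, by simp [hne.symm, hjj]⟩
      · exact Or.inr ⟨Or.inr rfl, by simp [hne'.symm, hjj.symm]⟩)
  have h4 := card_symmDiff_add (A ∩ Lᶜ) (A' ∩ Lᶜ)
  have h5 : (A ∩ Lᶜ) ∆ (A' ∩ Lᶜ) = A ∆ A' ∩ Lᶜ := (inf_symmDiff_distrib_right A A' Lᶜ).symm
  rw [← Finset.inter_inter_distrib_right, h1, h2, h5, h3] at h4
  rw [Finset.card_erase_of_mem (by simp only [mem_inter]; exact ⟨⟨hvA, hvA'⟩, hv⟩)]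
  omega

/-- `W ∩ Z` contains `u` and `v`, and otherwise at most `j` and `p`; being even, it contains both or
neither. -/
theorem mem_iff_mem (hP : IsGolayFamily P) {u v j p : Fin 24}
    (hj : u ≠ j) (hp : v ≠ p)
    {W Z : Finset (Fin 24)} (hW : P W) (hZ : P Z) (hWL : W ∩ L = {u, j}) (hvW : v ∈ W)
    (hZL : Z ∩ Lᶜ = {v, p}) (huZ : u ∈ Z) : j ∈ Z ↔ p ∈ W := by
  have h1 := hP.even_card_inter hW hZ
  rw [card_eq_card_inter_add (W ∩ Z) L] at h1
  have h2 : W ∩ Z ∩ L = ({u, j} : Finset (Fin 24)) ∩ Z := by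
    rw [← hWL, Finset.inter_right_comm]
  have h3 : W ∩ Z ∩ Lᶜ = ({v, p} : Finset (Fin 24)) ∩ W := by
    rw [← hZL, Finset.inter_assoc, Finset.inter_comm]
  rw [h2, h3, Finset.insert_inter_of_mem huZ, Finset.insert_inter_of_mem hvW] at h1
  by_cases hjZ : j ∈ Z <;> by_cases hpW : p ∈ W
  · simp [hjZ, hpW]
  · rw [Finset.singleton_inter_of_mem hjZ, Finset.singleton_inter_of_notMem hpW,
      Finset.card_pair hj] at h1
    exact absurd h1 (by simp; decide)
  · rw [Finset.singleton_inter_of_notMem hjZ, Finset.singleton_inter_of_mem hpW,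
      Finset.card_pair hp] at h1
    exact absurd h1 (by simp; decide)
  · simp [hjZ, hpW]

theorem card_filter_subtype_mem {M S : Finset (Fin 24)} {v : Fin 24}
    (q : {p // p ∈ M ∧ p ≠ v} → Prop) [DecidablePred q] (hq : ∀ p, q p ↔ p.1 ∈ S) :
    #{p | q p} = #((S ∩ M).erase v) := by
  rw [← Finset.card_image_of_injective _ Subtype.val_injective]
  congr 1
  ext x
  simp only [mem_image, mem_filter, mem_univ, true_and, mem_erase, mem_inter, Subtype.exists,
    exists_and_right, exists_eq_right, hq]
  tauto

theorem card_subtype_mem {M : Finset (Fin 24)} {v : Fin 24} (hM : #M = 12) (hv : v ∈ M) :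
    Fintype.card {p // p ∈ M ∧ p ≠ v} = 11 := by
  have := card_filter_subtype_mem (M := M) (S := M) (v := v) (fun _ => True) fun p => by simp [p.2.1]
  rw [Finset.filter_true, Finset.card_univ, Finset.inter_self, Finset.card_erase_of_mem hv, hM]
    at this
  exact this

end IsGolayFamily

/-! ### The standard model and uniqueness of Golay families -/

/-- The positions of the standard model of the extended Golay code. -/
abbrev GolayPosition : Type :=
  Option (Option (Fin 2 × Fin 5)) ⊕ Option (Fin 5 ⊕ Option (Fin 5))

/-- A dodecad of the standard model of the extended Golay code. -/
def golayHalf : Finset GolayPosition := univ.filter (·.isLeft)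

/-- The indicator of the word of the standard model attached to a point of the biplane. -/
def golayColumnIndicator (j : Fin 5 ⊕ Option (Fin 5)) : GolayPosition → Bool
  | .inl none => true
  | .inl (some i) => pentagonBiplane i j
  | .inr none => true
  | .inr (some j') => j' = j

/-- The words of the standard model of the extended Golay code attached to the points of the
biplane. -/
def golayColumn (j : Fin 5 ⊕ Option (Fin 5)) : Finset GolayPosition :=
  univ.filter fun x => golayColumnIndicator j x = true

theorem mem_golayColumn {j : Fin 5 ⊕ Option (Fin 5)} {x : GolayPosition} :
    x ∈ golayColumn j ↔ golayColumnIndicator j x = true := by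
  simp [golayColumn]

theorem card_golayHalf : #golayHalf = 12 := by decide

namespace IsGolayFamily

variable {P : Finset (Fin 24) → Prop} {L : Finset (Fin 24)}

/-- The words `W j` through `v` and `Z p` through `u` describe the same incidence relation by
`mem_iff_mem`. The row conditions of a biplane come from `W`, the column conditions from `Z` with
`L` and `Lᶜ` exchanged. Coordinates for the biplane then give coordinates for all 24 positions. -/
theorem exists_position_equiv (hP : IsGolayFamily P) (hL : P L) (hc : #L = 12) :
    ∃ σ : GolayPosition ≃ Fin 24,
      P (golayHalf.image σ) ∧ ∀ j, P ((golayColumn j).image σ) := by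
  have hL' := hP.compl_mem hL
  have hc' := card_compl hc
  obtain ⟨u, hu⟩ : L.Nonempty := Finset.card_pos.mp (by omega)
  obtain ⟨v, hv⟩ : Lᶜ.Nonempty := Finset.card_pos.mp (by omega)
  have hu' : u ∈ Lᶜᶜ := by rwa [compl_compl]
  have hWex : ∀ j : {j // j ∈ L ∧ j ≠ u}, ∃ A, P A ∧ A ∩ L = {u, j.1} ∧ v ∈ A := fun j =>
    hP.exists_inter_eq_mem hL hc hu hv j.2.1 j.2.2.symm
  have hZex : ∀ p : {p // p ∈ Lᶜ ∧ p ≠ v}, ∃ A, P A ∧ A ∩ Lᶜ = {v, p.1} ∧ u ∈ A := fun p =>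
    hP.exists_inter_eq_mem hL' hc' hv hu' p.2.1 p.2.2.symm
  choose W hW hWL hvW using hWex
  choose Z hZ hZL huZ using hZex
  have hinc : ∀ j p, j.1 ∈ Z p ↔ p.1 ∈ W j := fun j p =>
    hP.mem_iff_mem j.2.2.symm p.2.2.symm (hW j) (hZ p) (hWL j) (hvW j) (hZL p) (huZ p)
  have hb : IsBiplane fun (j : {j // j ∈ L ∧ j ≠ u}) (p : {p // p ∈ Lᶜ ∧ p ≠ v}) => p.1 ∈ W j := by
    refine ⟨card_subtype_mem hc hu, card_subtype_mem hc' hv, fun j => ?_, fun j j' hjj => ?_,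
      fun p => ?_, fun p p' hpp => ?_⟩
    · rw [card_filter_subtype_mem (S := W j) _ fun p => Iff.rfl]
      exact hP.card_block hL hc hv j.2.2.symm (hW j) (hWL j) (hvW j)
    · rw [card_filter_subtype_mem (S := W j ∩ W j') _ fun p => Finset.mem_inter.symm]
      exact hP.card_block_inter hL hc hv j.2.2.symm j'.2.2.symm (fun h => hjj (Subtype.ext h))
        (hW j) (hWL j) (hvW j) (hW j') (hWL j') (hvW j')
    · rw [card_filter_subtype_mem (S := Z p) _ fun j => (hinc j p).symm]
      have := hP.card_block hL' hc' hu' p.2.2.symm (hZ p) (hZL p) (huZ p)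
      rwa [compl_compl] at this
    · rw [card_filter_subtype_mem (S := Z p ∩ Z p') _ fun j => by
        rw [Finset.mem_inter, hinc, hinc]]
      have := hP.card_block_inter hL' hc' hu' p.2.2.symm p'.2.2.symm
        (fun h => hpp (Subtype.ext h)) (hZ p) (hZL p) (huZ p) (hZ p') (hZL p') (huZ p')
      rwa [compl_compl] at this
  obtain ⟨f, g, hfg⟩ := hb.exists_equiv
  let s : GolayPosition → Fin 24 :=
    Sum.elim (fun i => i.elim u fun i => (f i).1) (fun j => j.elim v fun j => (g j).1)
  have hs : Function.Bijective s := by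
    refine (Fintype.bijective_iff_surjective_and_card s).mpr ⟨fun x => ?_, rfl⟩
    by_cases hx : x ∈ L
    · by_cases hxu : x = u
      · exact ⟨.inl none, hxu.symm⟩
      · exact ⟨.inl (some (f.symm ⟨x, hx, hxu⟩)), by simp [s]⟩
    · by_cases hxv : x = v
      · exact ⟨.inr none, hxv.symm⟩
      · exact ⟨.inr (some (g.symm ⟨x, Finset.mem_compl.mpr hx, hxv⟩)), by simp [s]⟩
  have himage : ∀ (T : Finset GolayPosition) (A : Finset (Fin 24)),
      (∀ x, s x ∈ A ↔ x ∈ T) → T.image (Equiv.ofBijective s hs) = A := by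
    intro T A h
    ext y
    obtain ⟨x, rfl⟩ := hs.2 y
    rw [h, ← (Equiv.ofBijective s hs).injective.mem_finset_image]
    rfl
  refine ⟨Equiv.ofBijective s hs, ?_, fun j => ?_⟩
  · rw [himage golayHalf L ?_]
    · exact hL
    · rintro ((_ | i) | (_ | j))
      · simp [s, golayHalf, hu]
      · simpa [s, golayHalf] using (f i).2.1
      · simpa [s, golayHalf] using hv
      · simpa [s, golayHalf] using (g j).2.1
  · rw [himage (golayColumn j) (Z (g j)) ?_]
    · exact hZ (g j)
    · have hZmem : ∀ x, x ∈ Lᶜ → (x ∈ Z (g j) ↔ x = v ∨ x = (g j).1) := fun x hx => by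
        have := Finset.ext_iff.mp (hZL (g j)) x
        simpa [hx, Finset.mem_compl.mp hx] using this
      rintro ((_ | i) | (_ | j'))
      · simp [s, mem_golayColumn, golayColumnIndicator, huZ]
      · simp [s, mem_golayColumn, golayColumnIndicator, hinc, hfg]
      · simp [s, mem_golayColumn, golayColumnIndicator, hZmem v hv]
      · simp [s, mem_golayColumn, golayColumnIndicator, hZmem _ (g j').2.1, (g j').2.2, Subtype.val_inj]

/-- A Golay family is generated by a dodecad and words meeting its complement in two positions. -/
theorem generated (hP : IsGolayFamily P) (hL : P L) (hc : #L = 12) {v : Fin 24}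
    {Z : Fin 24 → Finset (Fin 24)} (hZ : ∀ p ∈ Lᶜ, p ≠ v → P (Z p))
    (hZL : ∀ p ∈ Lᶜ, p ≠ v → Z p ∩ Lᶜ = {v, p}) {Q : Finset (Fin 24) → Prop}
    (hQ : ∀ {A B}, Q A → Q B → Q (A ∆ B)) (hQL : Q L) (hQZ : ∀ p ∈ Lᶜ, p ≠ v → Q (Z p))
    {A : Finset (Fin 24)} (hA : P A) : Q A := by
  -- Adding `Z p` removes `p` from the trace on `Lᶜ` and otherwise changes that trace at most at
  -- `v`. Once at most `v` is left, evenness clears it and `A` lies inside `L`.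
  induction hn : #((A ∩ Lᶜ).erase v) using Nat.strong_induction_on generalizing A with
  | _ n ih =>
    by_cases hne : ((A ∩ Lᶜ).erase v).Nonempty
    · obtain ⟨p, hp⟩ := hne
      have hp' := hp
      rw [Finset.mem_erase, Finset.mem_inter] at hp'
      obtain ⟨hpv, hpA, hpL⟩ := hp'
      have hlt : #(((A ∆ Z p) ∩ Lᶜ).erase v) < n := by
        rw [← hn]
        refine Finset.card_lt_card ⟨fun x hx => ?_, fun hsub => ?_⟩
        · have hZx := Finset.ext_iff.mp (hZL p hpL hpv) x
          simp only [mem_inter, mem_erase, mem_symmDiff, mem_insert, mem_singleton] at hx hZx ⊢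
          obtain ⟨hxv, hx, hxL⟩ := hx
          refine ⟨hxv, ?_, hxL⟩
          rcases hx with hx | hx
          · exact hx.1
          · rcases hZx.mp ⟨hx.1, hxL⟩ with h | h
            · exact absurd h hxv
            · exact h ▸ hpA
        · have h1 := hsub hp
          have hZx := Finset.ext_iff.mp (hZL p hpL hpv) p
          simp only [mem_inter, mem_erase, mem_symmDiff, mem_insert, mem_singleton] at h1 hZx
          tauto
      have := hQ (ih _ hlt (hP.symmDiff_mem hA (hZ p hpL hpv)) rfl) (hQZ p hpL hpv)
      rwa [symmDiff_symmDiff_cancel_right] at this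
    · rw [Finset.not_nonempty_iff_eq_empty] at hne
      have h1 : #(A ∩ Lᶜ) ≤ 1 := by
        have := Finset.pred_card_le_card_erase (a := v) (s := A ∩ Lᶜ)
        rw [hne, Finset.card_empty] at this
        omega
      have h2 := hP.even_card_inter hA (hP.compl_mem hL)
      have h3 : #(A ∩ Lᶜ) = 0 := by
        obtain ⟨m, hm⟩ := h2
        omega
      have h4 := card_eq_card_inter_add A L
      have h5 := card_symmDiff_add A L
      -- Two nonempty complementary parts of `L` would need at least 16 positions.
      have h6 : A = ∅ ∨ A ∆ L = ∅ := by
        by_contra! hcon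
        have := hP.eight_le hA (Finset.nonempty_iff_ne_empty.mp hcon.1)
        have := hP.eight_le (hP.symmDiff_mem hA hL) (Finset.nonempty_iff_ne_empty.mp hcon.2)
        omega
      rcases h6 with rfl | h6
      · have := hQ hQL hQL
        rwa [symmDiff_self] at this
      · rwa [symmDiff_eq_bot.mp h6]

/-- Any two Golay families containing dodecads are equivalent. -/
theorem exists_perm (hP : IsGolayFamily P) (hL : P L) (hc : #L = 12)
    {P' : Finset (Fin 24) → Prop} {L' : Finset (Fin 24)} (hP' : IsGolayFamily P') (hL' : P' L')
    (hc' : #L' = 12) : ∃ τ : Equiv.Perm (Fin 24), ∀ A, P A → P' (A.image τ) := by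
  obtain ⟨σ, hσL, hσ⟩ := hP.exists_position_equiv hL hc
  obtain ⟨σ', hσL', hσ'⟩ := hP'.exists_position_equiv hL' hc'
  have hτ : ∀ T : Finset GolayPosition, (T.image σ).image (σ.symm.trans σ') = T.image σ' := by
    intro T
    rw [Finset.image_image]
    congr 1
    ext x
    simp
  -- The value `∅` is never used: `generated` only concerns positions of the right half other than
  -- the distinguished one.
  let Z : Fin 24 → Finset (Fin 24) := fun p =>
    match σ.symm p with
    | .inr (some j) => (golayColumn j).image σ
    | _ => ∅
  have key : ∀ p ∈ (golayHalf.image σ)ᶜ, p ≠ σ (.inr none) →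
      ∃ j, p = σ (.inr (some j)) ∧ Z p = (golayColumn j).image σ := by
    intro p hp hpv
    obtain ⟨x, rfl⟩ := σ.surjective p
    rw [Finset.mem_compl, σ.injective.mem_finset_image] at hp
    rcases x with i | (_ | j)
    · exact absurd (by simp [golayHalf]) hp
    · exact absurd rfl hpv
    · exact ⟨j, rfl, by simp [Z]⟩
  refine ⟨σ.symm.trans σ', fun A hA => ?_⟩
  refine hP.generated (Q := fun A => P' (A.image (σ.symm.trans σ'))) (v := σ (.inr none)) (Z := Z)
    hσL ?_ (fun p hp hpv => ?_) (fun p hp hpv => ?_) (fun {A B} h1 h2 => ?_) ?_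
    (fun p hp hpv => ?_) hA
  · rw [Finset.card_image_of_injective _ σ.injective, card_golayHalf]
  · obtain ⟨j, rfl, hj⟩ := key p hp hpv
    rw [hj]
    exact hσ j
  · obtain ⟨j, rfl, hj⟩ := key p hp hpv
    rw [hj]
    ext y
    obtain ⟨x, rfl⟩ := σ.surjective y
    rw [Finset.mem_inter, Finset.mem_compl, σ.injective.mem_finset_image,
      σ.injective.mem_finset_image, Finset.mem_insert, Finset.mem_singleton, σ.injective.eq_iff,
      σ.injective.eq_iff]
    rcases x with i | (_ | j')
    · simp [golayHalf]
    · simp [golayHalf, mem_golayColumn, golayColumnIndicator]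
    · simp [golayHalf, mem_golayColumn, golayColumnIndicator]
  · rw [Finset.image_symmDiff _ _ (Equiv.injective _)]
    exact hP'.symmDiff_mem h1 h2
  · rw [hτ]
    exact hσL'
  · obtain ⟨j, rfl, hj⟩ := key p hp hpv
    rw [hj, hτ]
    exact hσ' j

end IsGolayFamily

/-! ### Enumeration of the extended Golay code -/

/-- The word of length `24` whose entry at position `i` is the binary digit of `m` of weight
`2 ^ (23 - i)`. -/
def wordOfNat (m : ℕ) : Fin 24 → ZMod 2 := fun i => if m.testBit (23 - i) then 1 else 0

/-- All sums modulo `2` of sublists of a list of binary numbers. -/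
def xorSpan : List ℕ → List ℕ
  | [] => [0]
  | r :: l => xorSpan l ++ (xorSpan l).map (r ^^^ ·)

/-- The number of ones among the binary digits of a number less than `16`. -/
def nibbleWeight (d : ℕ) : ℕ := (0x4332322132212110 >>> (4 * d)) % 16

/-- The number of ones among the `24` lowest binary digits. -/
def binaryWeight (m : ℕ) : ℕ :=
  nibbleWeight (m % 16) + nibbleWeight (m / 16 % 16) + nibbleWeight (m / 256 % 16) +
    nibbleWeight (m / 4096 % 16) + nibbleWeight (m / 65536 % 16) + nibbleWeight (m / 1048576 % 16)

/-- The hexadecimal digits of the constant are, from the lowest, the bit counts of 0, 1, ..., 15. -/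
theorem nibbleWeight_eq (d : ℕ) :
    nibbleWeight (d % 16) = d % 2 + d / 2 % 2 + d / 4 % 2 + d / 8 % 2 := by
  have h : ∀ e < 16, nibbleWeight e = e % 2 + e / 2 % 2 + e / 4 % 2 + e / 8 % 2 := by decide
  rw [h _ (Nat.mod_lt _ (by decide))]
  omega

theorem wordOfNat_xor (a b : ℕ) : wordOfNat (a ^^^ b) = wordOfNat a + wordOfNat b := by
  ext i
  simp only [wordOfNat, Nat.testBit_xor, Pi.add_apply]
  cases a.testBit (23 - i) <;> cases b.testBit (23 - i) <;> decide

theorem wordOfNat_zero : wordOfNat 0 = 0 := by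
  ext i
  simp [wordOfNat]

theorem wordOfNat_injOn {a b : ℕ} (ha : a < 2 ^ 24) (hb : b < 2 ^ 24)
    (h : wordOfNat a = wordOfNat b) : a = b := by
  refine Nat.eq_of_testBit_eq fun i => ?_
  by_cases hi : i < 24
  · have := congrFun h ⟨23 - i, by omega⟩
    simp only [wordOfNat] at this
    rw [show 23 - (23 - i) = i by omega] at this
    revert this
    cases a.testBit i <;> cases b.testBit i <;> decide
  · rw [Nat.testBit_lt_two_pow (ha.trans_le (Nat.pow_le_pow_right (by decide) (by omega))),
      Nat.testBit_lt_two_pow (hb.trans_le (Nat.pow_le_pow_right (by decide) (by omega)))]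

theorem hammingNorm_wordOfNat (m : ℕ) : hammingNorm (wordOfNat m) = binaryWeight m := by
  have h1 : hammingNorm (wordOfNat m) = ∑ i : Fin 24, (m.testBit (23 - i)).toNat := by
    rw [hammingNorm, Finset.card_filter]
    refine Finset.sum_congr rfl fun i _ => ?_
    rw [wordOfNat]
    cases m.testBit (23 - i) <;> simp
  rw [h1, binaryWeight]
  simp only [Nat.toNat_testBit]
  rw [Fin.sum_univ_eq_sum_range fun i => m / 2 ^ (23 - i) % 2,
    Finset.sum_range_reflect (fun i => m / 2 ^ i % 2) 24]
  simp only [Finset.sum_range_succ, Finset.sum_range_zero, nibbleWeight_eq, Nat.div_div_eq_div_mul]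
  norm_num
  ring

theorem span_wordOfNat (l : List ℕ) (x : Fin 24 → ZMod 2) :
    x ∈ Submodule.span (ZMod 2) (wordOfNat '' {r | r ∈ l}) ↔ ∃ m ∈ xorSpan l, wordOfNat m = x := by
  induction l generalizing x with
  | nil => simp [xorSpan, wordOfNat_zero, eq_comm]
  | cons r l ih =>
    have hset : wordOfNat '' {s | s ∈ r :: l} = insert (wordOfNat r) (wordOfNat '' {s | s ∈ l}) := by
      rw [← Set.image_insert_eq]
      congr 1
      ext s
      simp
    rw [hset, Submodule.mem_span_insert]
    simp only [ih, xorSpan, List.mem_append, List.mem_map]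
    constructor
    · rintro ⟨a, _, ⟨m, hm, rfl⟩, rfl⟩
      rcases (by decide : ∀ a : ZMod 2, a = 0 ∨ a = 1) a with rfl | rfl
      · exact ⟨m, Or.inl hm, by simp⟩
      · exact ⟨r ^^^ m, Or.inr ⟨m, hm, rfl⟩, by rw [wordOfNat_xor, one_smul]⟩
    · rintro ⟨_, hm | ⟨m, hm, rfl⟩, rfl⟩
      · exact ⟨0, _, ⟨_, hm, rfl⟩, by simp⟩
      · exact ⟨1, _, ⟨m, hm, rfl⟩, by rw [wordOfNat_xor, one_smul]⟩

/-- The rows of the generator matrix of the extended Golay code, as binary numbers. -/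
def golayRows : List ℕ := 
  [8392133, 4196067, 2100081, 1050041, 525021, 262511, 133303, 68699,
    36397, 18199, 11147, 8190]

theorem wordOfNat_golayRows_apply : ∀ p : Fin 12 × Fin 24,
    wordOfNat (golayRows.getD p.1 0) p.2 = golayGenerator p.1 p.2 := by
  decide +kernel

theorem wordOfNat_golayRows (i : Fin 12) : wordOfNat (golayRows.getD i 0) = golayGenerator i :=
  funext fun j => wordOfNat_golayRows_apply (i, j)

theorem mem_extendedGolayCode (x : Fin 24 → ZMod 2) :
    x ∈ extendedGolayCode ↔ ∃ m ∈ xorSpan golayRows, wordOfNat m = x := by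
  rw [← span_wordOfNat, extendedGolayCode]
  have : Set.range golayGenerator.row = wordOfNat '' {r | r ∈ golayRows} := by
    ext y
    constructor
    · rintro ⟨i, rfl⟩
      have hi : (i : ℕ) < golayRows.length := i.2
      refine ⟨golayRows.getD i 0, ?_, wordOfNat_golayRows i⟩
      rw [List.getD_eq_getElem _ _ hi]
      exact List.getElem_mem _
    · rintro ⟨r, hr, rfl⟩
      obtain ⟨i, hi, rfl⟩ := List.mem_iff_getElem.mp hr
      refine ⟨⟨i, hi⟩, ?_⟩
      rw [← List.getD_eq_getElem _ 0 hi]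
      exact (wordOfNat_golayRows ⟨i, hi⟩).symm
  rw [this]

/-- Whether a list is strictly increasing and its entries are larger than `a`. -/
def increasingFrom : ℕ → List ℕ → Bool
  | _, [] => true
  | a, b :: l => a.blt b && increasingFrom b l

theorem isChain_of_increasingFrom {a : ℕ} {l : List ℕ} (h : increasingFrom a l = true) :
    (a :: l).IsChain (· < ·) := by
  induction l generalizing a with
  | nil => simp
  | cons b l ih =>
    rw [increasingFrom, Bool.and_eq_true, Nat.blt_eq] at h
    exact List.IsChain.cons_cons h.1 (ih h.2)

/-- The identity block makes the enumeration increasing, so comparing neighbours suffices to see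
that the 4096 numbers are distinct. -/
theorem increasingFrom_xorSpan_golayRows : increasingFrom 0 (xorSpan golayRows).tail = true := by
  decide +kernel

theorem xorSpan_golayRows_nodup : (xorSpan golayRows).Nodup := by
  have h := isChain_of_increasingFrom increasingFrom_xorSpan_golayRows
  have h2 : xorSpan golayRows = 0 :: (xorSpan golayRows).tail := rfl
  rw [h2]
  exact (List.isChain_iff_pairwise.mp h).imp fun hab => hab.ne

/-- The bound 16777216 = 2^24 is what makes `wordOfNat` injective on the list. -/
theorem xorSpan_golayRows_spec :
    ((xorSpan golayRows).all fun m =>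
      (Nat.beq m 0 || Nat.ble 8 (binaryWeight m)) && Nat.blt m 16777216) = true ∧
    ((xorSpan golayRows).filter fun m => Nat.beq (binaryWeight m) 12).length = 2576 := by
  decide +kernel

theorem wordOfNat_injOn_xorSpan : Set.InjOn wordOfNat {m | m ∈ xorSpan golayRows} :=
  fun a ha b hb h => by
    have hlt := List.all_eq_true.mp xorSpan_golayRows_spec.1
    simp only [Bool.and_eq_true, Nat.blt_eq] at hlt
    exact wordOfNat_injOn (hlt a ha).2 (hlt b hb).2 h

theorem eight_le_hammingNorm_of_mem {x : Fin 24 → ZMod 2} (hx : x ∈ extendedGolayCode)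
    (hne : x ≠ 0) : 8 ≤ hammingNorm x := by
  obtain ⟨m, hm, rfl⟩ := (mem_extendedGolayCode x).mp hx
  have h := List.all_eq_true.mp xorSpan_golayRows_spec.1 m hm
  rw [Bool.and_eq_true, Bool.or_eq_true, Nat.beq_eq, Nat.ble_eq] at h
  rw [hammingNorm_wordOfNat]
  refine h.1.resolve_left ?_
  rintro rfl
  exact hne wordOfNat_zero

theorem ncard_golayDodecads : golayDodecads.ncard = 2576 := by
  set l := (xorSpan golayRows).filter fun m => Nat.beq (binaryWeight m) 12 with hl
  have hset : golayDodecads = wordOfNat '' (l.toFinset : Set ℕ) := by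
    ext x
    simp only [golayDodecads, Set.mem_ofPred_eq, mem_extendedGolayCode, Set.mem_image,
      Finset.mem_coe, List.mem_toFinset, hl, List.mem_filter, Nat.beq_eq]
    constructor
    · rintro ⟨⟨m, hm, rfl⟩, h⟩
      exact ⟨m, ⟨hm, by rwa [hammingNorm_wordOfNat] at h⟩, rfl⟩
    · rintro ⟨m, ⟨hm, h⟩, rfl⟩
      exact ⟨⟨m, hm, rfl⟩, by rwa [hammingNorm_wordOfNat]⟩
  rw [hset, Set.InjOn.ncard_image, Set.ncard_coe_finset, List.toFinset_card_of_nodup]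
  · exact xorSpan_golayRows_spec.2
  · exact xorSpan_golayRows_nodup.filter _
  · exact wordOfNat_injOn_xorSpan.mono fun m hm => by
      rw [Finset.mem_coe, List.mem_toFinset, hl, List.mem_filter] at hm
      exact hm.1

theorem isConstantWeightCode_golayDodecads :
    BinaryCode.IsConstantWeightCode 24 8 12 golayDodecads := by
  refine ⟨fun u hu => hu.2, (BinaryCode.le_minDist_iff _ _).mpr fun u hu v hv huv => ?_⟩
  rw [hammingDist_eq_hammingNorm]
  exact eight_le_hammingNorm_of_mem (Submodule.add_mem _ (Submodule.neg_mem _ hu.1) hv.1)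
    fun h => huv (neg_add_eq_zero.mp h)

/-! ### From codes to families of supports, and the conclusion -/

section Supports

variable {C : BinaryCode 24}

/-- The supports of the words of a code. -/
noncomputable def codeSupports (C : BinaryCode 24) : Finset (Finset (Fin 24)) :=
  (Set.toFinite (wordSupport '' C)).toFinset

theorem mem_codeSupports {A : Finset (Fin 24)} : A ∈ codeSupports C ↔ wordOf A ∈ C := by
  rw [codeSupports, Set.Finite.mem_toFinset]
  constructor
  · rintro ⟨x, hx, rfl⟩
    rwa [wordOf_wordSupport]
  · intro h
    exact ⟨_, h, wordSupport_wordOf A⟩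

theorem card_codeSupports : #(codeSupports C) = C.ncard := by
  rw [codeSupports, ← Set.ncard_eq_toFinset_card, Set.ncard_image_of_injective]
  exact Function.LeftInverse.injective wordOf_wordSupport

theorem isGolayFamily_of_isConstantWeightCode (hC : BinaryCode.IsConstantWeightCode 24 8 12 C)
    (hcard : C.ncard = 2576) : IsGolayFamily fun A => wordOf A ∈ wordSpan (codeSupports C) := by
  have hw : ∀ A ∈ codeSupports C, #A = 12 := fun A hA => by
    rw [← hammingNorm_wordOf]
    exact hC.weight_eq _ (mem_codeSupports.mp hA)
  refine isGolayFamily_wordSpan hw (fun A hA B hB hne => ?_) (card_codeSupports.trans hcard)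
  have h1 := (BinaryCode.le_minDist_iff C 8).mp hC.le_minDist _ (mem_codeSupports.mp hA) _
    (mem_codeSupports.mp hB) (wordOf_injective.ne hne)
  have h2 := card_symmDiff_add A B
  rw [hammingDist_wordOf] at h1
  rw [hw A hA, hw B hB] at h2
  omega

end Supports

/-- This inclusion is enough: images of codewords need only land in the Golay code, where their
weight 12 makes them dodecads. -/
theorem wordSpan_codeSupports_golayDodecads_le :
    wordSpan (codeSupports golayDodecads) ≤ extendedGolayCode := by
  rw [wordSpan, Submodule.span_le]
  rintro _ ⟨A, hA, rfl⟩
  exact (mem_codeSupports.mp hA).1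

theorem wordOf_mem_wordSpan_codeSupports {C : BinaryCode 24} {A : Finset (Fin 24)}
    (hA : wordOf A ∈ C) : wordOf A ∈ wordSpan (codeSupports C) :=
  Submodule.subset_span ⟨A, mem_codeSupports.mpr hA, rfl⟩

theorem exists_dodecad {C : BinaryCode 24} (hC : BinaryCode.IsConstantWeightCode 24 8 12 C)
    (hcard : C.ncard = 2576) : ∃ L, wordOf L ∈ wordSpan (codeSupports C) ∧ #L = 12 := by
  obtain ⟨x, hx⟩ := Set.nonempty_of_ncard_ne_zero (s := C) (by rw [hcard]; decide)
  refine ⟨wordSupport x, wordOf_mem_wordSpan_codeSupports (by rwa [wordOf_wordSupport]), ?_⟩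
  rw [← hammingNorm_wordOf, wordOf_wordSupport]
  exact hC.weight_eq x hx

theorem mainTheorem6 :
    (BinaryCode.IsConstantWeightCode 24 8 12 golayDodecads ∧ golayDodecads.ncard = 2576) ∧
    ∀ C : BinaryCode 24, BinaryCode.IsConstantWeightCode 24 8 12 C → C.ncard = 2576 →
      BinaryCode.PermEquiv golayDodecads C := by
  refine ⟨⟨isConstantWeightCode_golayDodecads, ncard_golayDodecads⟩, fun C hC hcard => ?_⟩
  obtain ⟨L, hL, hLcard⟩ := exists_dodecad hC hcard
  obtain ⟨L', hL', hLcard'⟩ := exists_dodecad isConstantWeightCode_golayDodecads ncard_golayDodecads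
  obtain ⟨τ, hτ⟩ := (isGolayFamily_of_isConstantWeightCode hC hcard).exists_perm hL hLcard
    (isGolayFamily_of_isConstantWeightCode isConstantWeightCode_golayDodecads ncard_golayDodecads)
    hL' hLcard'
  -- Only the inclusion of `C` in the permuted dodecads is checked by hand; both sets have at most
  -- 2576 words, and `C` has exactly that many.
  refine ⟨τ, Set.eq_of_subset_of_ncard_le (fun x hx => ?_) ?_ (Set.toFinite _)⟩
  · refine ⟨wordOf ((wordSupport x).image τ), ⟨wordSpan_codeSupports_golayDodecads_le
      (hτ _ (wordOf_mem_wordSpan_codeSupports (by rwa [wordOf_wordSupport]))), ?_⟩, ?_⟩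
    · rw [hammingNorm_wordOf, Finset.card_image_of_injective _ τ.injective, ← hammingNorm_wordOf,
        wordOf_wordSupport, hC.weight_eq x hx]
    · conv_rhs => rw [← wordOf_wordSupport x]
      ext i
      simp only [wordOf, τ.injective.mem_finset_image]
  · rw [hcard, ← ncard_golayDodecads]
    exact Set.ncard_image_le (Set.toFinite _)
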